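/- Let $R$ be a Dedekind domain (a field is allowed), let $M$ and $N$ be finitely generated $R$-modules, let $X:=\operatorname{Ass}_R(N)\setminus\{0\}$ be the set of nonzero associated primes of $N$, and let $t$ be a positive integer. Notation. For modules $A,B$ over a commutative ring $S$, $\operatorname{sur}_S(A,B)\in\{0,1,2,\dots\}\cup\{\infty\}$ is the supremum of the nonnegative integers $k$ for which there is a surjective $S$-linear map $A\to B^{\oplus k}$; we omit $S$ when it is understood, so $\operatorname{sur}(M_{\mathfrak m},N_{\mathfrak m})$ is taken over $R_{\mathfrak m}$. $\operatorname{Tor}(M)$ is the torsion submodule of $M$, and $\operatorname{rank}(M)$ is the rank of $M$, that is, the dimension of $K\otimes_R M$ over the fraction field $K$ of $R$. If $r=\operatorname{rank}(M)\ge 1$, the Steinitz class $[M]$ is the class, in the ideal class group of $R$, of a nonzero ideal $I$ of $R$ with $M/\operatorname{Tor}(M)\cong R^{\oplus(r-1)}\oplus I$. Then $\operatorname{sur}(M,N)\ge t$ if and only if $\operatorname{sur}(M_{\mathfrak m},N_{\mathfrak m})\ge t$ for every $\mathfrak m\in X$ and one of the following conditions holds: 1. $\operatorname{rank}(N)=0$;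 2. $\operatorname{rank}(M)\ge 1+t\cdot\operatorname{rank}(N)$; 3. $\operatorname{rank}(M)=t\cdot\operatorname{rank}(N)\ge t$ and $[M]=[N]^t$ in the class group of $R$. Moreover, if $\operatorname{sur}(M,N)\ge t$ and (3) holds, then $\operatorname{sur}(\operatorname{Tor}(M),\operatorname{Tor}(N))\ge t$ and $\operatorname{sur}(M,N)=t$. -/

import Mathlib

open scoped nonZeroDivisors

/-- The global surjective capacity of `M` with respect to `N` over `R`: the supremum in
`ℕ ∪ {∞}` of the nonnegative integers `t` such that there is a surjective `R`-linear map
from `M` to the direct sum of `t` copies of `N`. -/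
noncomputable def surCapacity (R M N : Type*) [CommRing R] [AddCommGroup M] [Module R M]
    [AddCommGroup N] [Module R N] : ℕ∞ :=
  sSup {c : ℕ∞ | ∃ t : ℕ, c = t ∧ ∃ f : M →ₗ[R] (Fin t → N), Function.Surjective f}

/-- The local surjective capacity of `M` with respect to `N` at the prime `p`: the surjective
capacity of `M_p` with respect to `N_p` over `R_p`. -/
noncomputable def localSurCapacity {R : Type*} (M N : Type*) [CommRing R] [AddCommGroup M]
    [Module R M] [AddCommGroup N] [Module R N] (p : PrimeSpectrum R) : ℕ∞ :=
  surCapacity (Localization.AtPrime p.asIdeal) (LocalizedModule p.asIdeal.primeCompl M)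
    (LocalizedModule p.asIdeal.primeCompl N)

/-- The nonzero ideal `I` represents the Steinitz class of `M`:
`M / Tor(M) ≅ R ^ (r - 1) ⊕ I`, where `r` is the rank of `M`.
(If `r = 0`, the left side is zero while the right side is not, so no `I` qualifies.) -/
def IsSteinitzIdeal {R : Type*} (M : Type*) [CommRing R] [IsDomain R] [AddCommGroup M]
    [Module R M] (I : (Ideal R)⁰) : Prop :=
  Nonempty ((M ⧸ Submodule.torsion R M) ≃ₗ[R]
    ((Fin (Module.finrank R M - 1) → R) × (I : Ideal R)))

open Classical in
/-- The Steinitz class of `M` in the class group of the Dedekind domain `R`: the class of an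
ideal `I` with `M / Tor(M) ≅ R ^ (r - 1) ⊕ I`.  For finitely generated `M ≠ Tor(M)` such an `I`
exists and its class is unique; in the other cases the value `1` is a convention. -/
noncomputable def steinitzClass (R M : Type*) [CommRing R] [IsDedekindDomain R]
    [AddCommGroup M] [Module R M] : ClassGroup R :=
  if h : ∃ I : (Ideal R)⁰, IsSteinitzIdeal M I then ClassGroup.mk0 h.choose else 1

/-- The third rank condition: `rank M = t * rank N ≥ t` and `[M] = [N] ^ t`. -/
def SteinitzCondition (R M N : Type*) [CommRing R] [IsDedekindDomain R] [AddCommGroup M]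
    [Module R M] [AddCommGroup N] [Module R N] (t : ℕ) : Prop :=
  Module.finrank R M = t * Module.finrank R N ∧ t ≤ t * Module.finrank R N ∧
    steinitzClass R M = steinitzClass R N ^ t

/-! Write `Q` for the `t`-th power of `N / Tor(N)`, a finitely generated torsion-free, hence
projective, module.

Necessity: surjections localize, and rank is additive, so `rank M ≥ t * rank N`. If equality holds
and `rank N > 0`, the kernel of `M → Q` has rank zero, so it is exactly `Tor(M)` and `M / Tor(M) ≅
Q`. The Steinitz class is an isomorphism invariant (by a determinant argument) and is multiplicative
on direct sums (`I ⊕ J ≅ R ⊕ I J`), whence `[M] = [N] ^ t`. The same kernel computation gives the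
surjection between torsion submodules, and the rank bound gives `sur(M, N) = t`.

Sufficiency: each rank condition produces a surjection `g : M → Q` by Steinitz's structure theorem.
It splits, so `M ≅ ker g ⊕ Q`, and likewise `N ^ t ≅ T ⊕ Q` with `T` torsion. At a nonzero
associated prime `p` of `N`, the local hypothesis gives a map `M → N ^ t` surjective modulo `p`;
cancelling `Q` (`LinearMap.exists_range_sup_smul_top_of_prod`) leaves a map `ker g → T` surjective
modulo `p`. There are finitely many such `p`, and `p T = T` at every other maximal ideal, so the
Chinese remainder theorem and Nakayama give a surjection `h : ker g → T`. Then `h ⊕ id` is the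
required map. -/

section Splitting

variable {R M P : Type*} [CommRing R] [AddCommGroup M] [Module R M] [AddCommGroup P] [Module R P]

/-- A surjection onto a projective module splits off its target. -/
theorem LinearMap.exists_equiv_ker_prod_of_surjective [Module.Projective R P] (g : M →ₗ[R] P)
    (hg : Function.Surjective g) :
    ∃ e : (LinearMap.ker g × P) ≃ₗ[R] M, ∀ x, g (e x) = x.2 := by
  obtain ⟨s, hs⟩ := Module.projective_lifting_property g LinearMap.id hg
  obtain ⟨e, -, he⟩ := (LinearMap.exact_subtype_ker_map g).splitSurjectiveEquiv
    (Submodule.subtype_injective _) ⟨s, hs⟩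
  exact ⟨e.symm, fun x => by simpa using LinearMap.congr_fun he (e.symm x)⟩

end Splitting

/-! ### Isomorphisms between ideals and their sums -/

section Ideals

variable {R : Type*} [CommRing R]

/-- For comaximal ideals, `I ⊕ J ≅ R ⊕ I J`. -/
theorem Ideal.nonempty_prod_equiv_of_sup_eq_top {I J : Ideal R} (h : I ⊔ J = ⊤) :
    Nonempty ((I × J) ≃ₗ[R] (R × (I * J : Ideal R))) := by
  -- The sum map is onto by comaximality, hence splits; its kernel is the antidiagonal copy of `I ⊓
  -- J = I * J`.
  let g : (I × J) →ₗ[R] R := I.subtype.coprod J.subtype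
  have hg : Function.Surjective g := by
    intro r
    have hr : r ∈ I ⊔ J := h ▸ Submodule.mem_top
    obtain ⟨a, ha, b, hb, rfl⟩ := Submodule.mem_sup.mp hr
    exact ⟨(⟨a, ha⟩, ⟨b, hb⟩), by simp [g]⟩
  obtain ⟨e, -⟩ := g.exists_equiv_ker_prod_of_surjective hg
  have hIJ : I * J = I ⊓ J := Ideal.mul_eq_inf_of_coprime h
  let k : LinearMap.ker g →ₗ[R] (I * J : Ideal R) :=
    LinearMap.codRestrict _ (I.subtype ∘ₗ LinearMap.fst R I J ∘ₗ (LinearMap.ker g).subtype) (by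
      rintro ⟨⟨a, b⟩, hab⟩
      have hab' : (a : R) + b = 0 := by simpa [g] using hab
      have : (a : R) ∈ I ⊓ J := ⟨a.2, by rw [eq_neg_of_add_eq_zero_left hab']; exact J.neg_mem b.2⟩
      rw [hIJ]; simpa using this)
  have hk : Function.Bijective k := by
    constructor
    · rw [injective_iff_map_eq_zero]
      rintro ⟨⟨a, b⟩, hab⟩ h0
      have hab' : (a : R) + b = 0 := by simpa [g] using hab
      have ha : (a : R) = 0 := by simpa [k] using congrArg Subtype.val h0
      have hb : (b : R) = 0 := by simpa [ha] using hab'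
      ext <;> simp [ha, hb]
    · rintro ⟨x, hx⟩
      rw [hIJ] at hx
      exact ⟨⟨(⟨x, hx.1⟩, ⟨-x, J.neg_mem hx.2⟩), by simp [g]⟩, by ext; simp [k]⟩
  exact ⟨e.symm ≪≫ₗ (LinearEquiv.ofBijective k hk).prodCongr (LinearEquiv.refl R R) ≪≫ₗ
    LinearEquiv.prodComm R _ _⟩

variable [IsDomain R]

/-- A nonzero ideal is isomorphic to its multiples by nonzero scalars. -/
theorem Ideal.nonempty_equiv_span_singleton_mul {x : R} (hx : x ≠ 0) (I : Ideal R) :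
    Nonempty (I ≃ₗ[R] (Ideal.span {x} * I : Ideal R)) := by
  let k : I →ₗ[R] (Ideal.span {x} * I : Ideal R) :=
    LinearMap.codRestrict _ (x • I.subtype) fun a =>
      Ideal.mul_mem_mul (Ideal.mem_span_singleton_self x) a.2
  refine ⟨LinearEquiv.ofBijective k ⟨?_, ?_⟩⟩
  · rw [injective_iff_map_eq_zero]
    intro a h0
    have : x * (a : R) = 0 := by simpa [k] using congrArg Subtype.val h0
    exact Subtype.ext ((mul_eq_zero.mp this).resolve_left hx)
  · rintro ⟨y, hy⟩
    obtain ⟨z, hz, rfl⟩ := Ideal.mem_span_singleton_mul.mp hy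
    exact ⟨⟨z, hz⟩, by ext; simp [k]⟩

end Ideals

/-! ### Ideal classes and `I ⊕ J ≅ R ⊕ I J` -/

section ClassGroup

variable {R : Type*} [CommRing R] [IsDedekindDomain R]

/-- Ideals in the same class are isomorphic. -/
theorem ClassGroup.nonempty_equiv_of_mk0_eq {I J : (Ideal R)⁰}
    (h : ClassGroup.mk0 I = ClassGroup.mk0 J) :
    Nonempty ((I : Ideal R) ≃ₗ[R] (J : Ideal R)) := by
  obtain ⟨x, y, hx, hy, h⟩ := ClassGroup.mk0_eq_mk0_iff.mp h
  obtain ⟨e⟩ := Ideal.nonempty_equiv_span_singleton_mul hx (I : Ideal R)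
  obtain ⟨e'⟩ := Ideal.nonempty_equiv_span_singleton_mul hy (J : Ideal R)
  exact ⟨e ≪≫ₗ LinearEquiv.ofEq _ _ h ≪≫ₗ e'.symm⟩

/-- Every ideal class has a representative that is comaximal with a given nonzero ideal. -/
theorem ClassGroup.exists_mk0_eq_sup_eq_top (I J : (Ideal R)⁰) :
    ∃ L : (Ideal R)⁰, ClassGroup.mk0 L = ClassGroup.mk0 I ∧ (L : Ideal R) ⊔ J = ⊤ := by
  obtain ⟨K, hK⟩ := ClassGroup.mk0_surjective (ClassGroup.mk0 I)⁻¹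
  have hK0 : (K : Ideal R) ≠ 0 := nonZeroDivisors.coe_ne_zero K
  have hJ0 : (J : Ideal R) ≠ 0 := nonZeroDivisors.coe_ne_zero J
  by_cases hJ : (J : Ideal R) = ⊤
  · exact ⟨I, rfl, by simp [hJ]⟩
  -- With `K` in the inverse class of `I`, choose `b` with `K J + (b) = K` and factor `(b) = K L`.
  -- Then `L` lies in the class of `I`, and cancelling `K` gives `J + L = R`. Since `J ≠ R`, `b` is
  -- nonzero.
  obtain ⟨b, hb⟩ := IsDedekindDomain.exists_sup_span_eq
    (Ideal.mul_le_left : (K : Ideal R) * J ≤ K) (mul_ne_zero hK0 hJ0)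
  have hbK : Ideal.span {b} ≤ (K : Ideal R) := hb ▸ le_sup_right
  obtain ⟨L, hL⟩ := Ideal.dvd_iff_le.mpr hbK
  have hb0 : Ideal.span {b} ≠ 0 := by
    intro h0
    rw [h0, Ideal.zero_eq_bot, sup_bot_eq] at hb
    exact hJ (by simpa using mul_left_cancel₀ hK0 (hb.trans (mul_one (K : Ideal R)).symm))
  have hL0 : L ≠ 0 := by rintro rfl; exact hb0 (by simpa using hL)
  refine ⟨⟨L, mem_nonZeroDivisors_of_ne_zero hL0⟩, ?_, ?_⟩
  · have h1 : ClassGroup.mk0 (K * ⟨L, mem_nonZeroDivisors_of_ne_zero hL0⟩) = 1 := by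
      rw [ClassGroup.mk0_eq_one_iff]
      change (K * L : Ideal R).IsPrincipal
      rw [← hL]; exact ⟨⟨b, rfl⟩⟩
    rw [map_mul, hK] at h1
    exact (inv_mul_eq_one.mp h1).symm
  · rw [hL, ← Ideal.add_eq_sup, ← mul_add] at hb
    have := mul_left_cancel₀ hK0 (hb.trans (mul_one (K : Ideal R)).symm)
    rw [sup_comm]; simpa using this

/-- Steinitz: `I ⊕ J ≅ R ⊕ I J` for nonzero ideals. -/
theorem nonempty_ideal_prod_equiv (I J : (Ideal R)⁰) :
    Nonempty ((↥(I : Ideal R) × ↥(J : Ideal R)) ≃ₗ[R] (R × ↥((I * J : (Ideal R)⁰) : Ideal R))) := by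
  obtain ⟨L, hL, hLJ⟩ := ClassGroup.exists_mk0_eq_sup_eq_top I J
  obtain ⟨e⟩ := ClassGroup.nonempty_equiv_of_mk0_eq hL
  obtain ⟨e'⟩ := Ideal.nonempty_prod_equiv_of_sup_eq_top hLJ
  obtain ⟨e''⟩ := ClassGroup.nonempty_equiv_of_mk0_eq (I := L * J) (J := I * J) (by simp [hL])
  exact ⟨e.symm.prodCongr (.refl R _) ≪≫ₗ e' ≪≫ₗ (LinearEquiv.refl R R).prodCongr e''⟩

end ClassGroup

/-! ### Invariance of the Steinitz class -/

section Determinant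

variable {R : Type*} [CommRing R]

/-- If the last coordinate of an endomorphism of `R ^ n ⊕ R` takes values in the ideal `J`, then
so does its determinant. -/
theorem LinearMap.det_mem_of_snd_mem {n : ℕ} (f : Module.End R ((Fin n → R) × R)) (J : Ideal R)
    (hf : ∀ w, (f w).2 ∈ J) : LinearMap.det f ∈ J := by
  classical
  let b := (Pi.basisFun R (Fin n)).prod (Module.Basis.singleton Unit R)
  rw [← LinearMap.det_toMatrix b, ← Ideal.Quotient.eq_zero_iff_mem, RingHom.map_det]
  refine Matrix.det_eq_zero_of_row_eq_zero (Sum.inr ()) fun j => ?_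
  rw [RingHom.mapMatrix_apply, Matrix.map_apply, Ideal.Quotient.eq_zero_iff_mem,
    LinearMap.toMatrix_apply]
  simpa [b] using hf _

variable [IsDomain R]

/-- The isomorphism class of `R ^ n ⊕ I` determines the ideal `I` up to scalars. -/
theorem exists_span_singleton_mul_eq_of_equiv {n : ℕ} {I J : Ideal R} (hI : I ≠ ⊥) (hJ : J ≠ ⊥)
    (e : ((Fin n → R) × I) ≃ₗ[R] ((Fin n → R) × J)) :
    ∃ x y : R, x ≠ 0 ∧ y ≠ 0 ∧ Ideal.span {x} * I = Ideal.span {y} * J := by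
  obtain ⟨a, ha, ha0⟩ := Submodule.exists_mem_ne_zero_of_ne_bot hI
  obtain ⟨b, hb, hb0⟩ := Submodule.exists_mem_ne_zero_of_ne_bot hJ
  -- Over the fraction field `e` has a determinant `q`, and the claim is `q I = J`. To stay over
  -- `R`, compose `e` with diagonal maps: `det (A x)` plays the role of `q x`, and `det (B y)` that
  -- of `q⁻¹ y`.
  let inc (I : Ideal R) : ((Fin n → R) × I) →ₗ[R] ((Fin n → R) × R) :=
    LinearMap.id.prodMap I.subtype
  let dg (I : Ideal R) (x : I) : ((Fin n → R) × R) →ₗ[R] ((Fin n → R) × I) :=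
    LinearMap.id.prodMap (LinearMap.toSpanSingleton R I x)
  let D (x : R) : Module.End R ((Fin n → R) × R) := LinearMap.id.prodMap (x • LinearMap.id)
  have hD (x : R) : LinearMap.det (D x) = x := by simp [D, LinearMap.det_prodMap]
  let A (x : I) : Module.End R ((Fin n → R) × R) := inc J ∘ₗ e.toLinearMap ∘ₗ dg I x
  let B (x : J) : Module.End R ((Fin n → R) × R) := inc I ∘ₗ e.symm.toLinearMap ∘ₗ dg J x
  have hA (x : I) : LinearMap.det (A x) ∈ J :=
    LinearMap.det_mem_of_snd_mem _ _ fun w => by simp [A, inc]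
  have hB (x : J) : LinearMap.det (B x) ∈ I :=
    LinearMap.det_mem_of_snd_mem _ _ fun w => by simp [B, inc]
  have dgD (I : Ideal R) (x y : I) : dg I x ∘ₗ D y = dg I y ∘ₗ D x := by
    refine LinearMap.ext fun w => Prod.ext rfl (Subtype.ext ?_)
    simp [dg, D]; ring
  have hAA (x y : I) : LinearMap.det (A x) * y = LinearMap.det (A y) * x := by
    have : A x * D y = A y * D x := by
      simp only [A, Module.End.mul_eq_comp, LinearMap.comp_assoc, dgD I x y]
    simpa [hD] using congrArg LinearMap.det this
  have hBB (x y : J) : LinearMap.det (B x) * y = LinearMap.det (B y) * x := by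
    have : B x * D y = B y * D x := by
      simp only [B, Module.End.mul_eq_comp, LinearMap.comp_assoc, dgD J x y]
    simpa [hD] using congrArg LinearMap.det this
  -- `C` scales the other coordinates by `a`, so that the middle of `A C B` becomes the scalar `a`
  -- and `e` cancels `e.symm`. Taking determinants yields `det A * det B = a * b`, that is, `q q⁻¹ =
  -- 1`.
  let C : Module.End R ((Fin n → R) × R) := (a • LinearMap.id).prodMap LinearMap.id
  have hC : LinearMap.det C = a ^ n := by simp [C, LinearMap.det_prodMap]
  have hdC : dg I ⟨a, ha⟩ ∘ₗ C ∘ₗ inc I = a • LinearMap.id := by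
    refine LinearMap.ext fun w => Prod.ext ?_ (Subtype.ext ?_)
    · simp [dg, C, inc]
    · simp [dg, C, inc]; ring
  have hACB : A ⟨a, ha⟩ * C * B ⟨b, hb⟩ = a • D b := by
    have h1 : A ⟨a, ha⟩ * C * B ⟨b, hb⟩ = inc J ∘ₗ e.toLinearMap ∘ₗ
        (dg I ⟨a, ha⟩ ∘ₗ C ∘ₗ inc I) ∘ₗ e.symm.toLinearMap ∘ₗ dg J ⟨b, hb⟩ := rfl
    rw [h1, hdC]
    refine LinearMap.ext fun w => Prod.ext ?_ ?_
    · simp [inc, dg, D]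
    · simp only [inc, dg, D, LinearMap.comp_apply, LinearMap.smul_apply, LinearMap.id_apply,
        LinearEquiv.coe_coe, map_smul, LinearEquiv.apply_symm_apply]
      simp [mul_comm]
  have hdet : LinearMap.det (A ⟨a, ha⟩) * LinearMap.det (B ⟨b, hb⟩) = a * b := by
    have := congrArg LinearMap.det hACB
    rw [map_mul, map_mul, hC, LinearMap.det_smul, hD] at this
    have hfin : Module.finrank R ((Fin n → R) × R) = n + 1 := by simp
    rw [hfin] at this
    refine mul_left_cancel₀ (pow_ne_zero n ha0) ?_
    linear_combination this
  have hne : LinearMap.det (A ⟨a, ha⟩) * LinearMap.det (B ⟨b, hb⟩) ≠ 0 := by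
    rw [hdet]; exact mul_ne_zero ha0 hb0
  refine ⟨_, a, left_ne_zero_of_mul hne, ha0, le_antisymm ?_ ?_⟩
  · rw [Ideal.span_singleton_mul_le_span_singleton_mul]
    intro x hx
    exact ⟨_, hA ⟨x, hx⟩, by rw [hAA ⟨a, ha⟩ ⟨x, hx⟩]; ring⟩
  · rw [Ideal.span_singleton_mul_le_span_singleton_mul]
    intro y hy
    refine ⟨_, hB ⟨y, hy⟩, mul_left_cancel₀ hb0 ?_⟩
    have h1 := hBB ⟨b, hb⟩ ⟨y, hy⟩
    simp only at h1
    linear_combination LinearMap.det (A ⟨a, ha⟩) * h1 - y * hdet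

end Determinant

/-! ### Additivity of rank -/

section Rank

variable {R M P : Type*} [CommRing R] [IsDomain R] [AddCommGroup M] [Module R M] [Module.Finite R M]
  [AddCommGroup P] [Module R P]

theorem LinearMap.finrank_add_finrank_ker_of_surjective (g : M →ₗ[R] P)
    (hg : Function.Surjective g) :
    Module.finrank R P + Module.finrank R (LinearMap.ker g) = Module.finrank R M := by
  rw [← Submodule.finrank_quotient_add_finrank (LinearMap.ker g),
    (g.quotKerEquivOfSurjective hg).finrank_eq]

/-- `M` need not be free, so no basis is available; instead the kernel of one coordinate projection
is a smaller power. -/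
theorem Module.finrank_fin_fun_eq_mul (t : ℕ) :
    Module.finrank R (Fin t → M) = t * Module.finrank R M := by
  induction t with
  | zero => simp [Module.finrank_zero_of_subsingleton]
  | succ t ih =>
    let g : (Fin (t + 1) → M) →ₗ[R] M := LinearMap.proj 0
    have hg : Function.Surjective g := fun x => ⟨fun _ => x, rfl⟩
    let e : (Fin t → M) →ₗ[R] LinearMap.ker g := LinearMap.codRestrict _
      (LinearMap.pi (Fin.cons 0 fun i => LinearMap.proj i)) (by intro x; simp [g])
    have he : Function.Bijective e := by
      constructor
      · intro x y hxy
        funext i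
        simpa [e] using congrFun (congrArg Subtype.val hxy) i.succ
      · rintro ⟨x, hx⟩
        refine ⟨fun i => x i.succ, Subtype.ext (funext fun i => ?_)⟩
        refine Fin.cases ?_ (fun i => ?_) i
        · exact (LinearMap.mem_ker.mp hx).symm
        · simp [e]
    rw [← g.finrank_add_finrank_ker_of_surjective hg,
      ← (LinearEquiv.ofBijective e he).finrank_eq, ih]
    ring

/-- The kernel has rank zero, so it is a torsion submodule of a torsion-free module. -/
theorem LinearMap.ker_eq_bot_of_surjective_of_finrank_eq [IsNoetherianRing R]
    [Module.IsTorsionFree R M] (g : M →ₗ[R] P) (hg : Function.Surjective g)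
    (h : Module.finrank R M = Module.finrank R P) : LinearMap.ker g = ⊥ := by
  have h1 := g.finrank_add_finrank_ker_of_surjective hg
  have h2 : Module.finrank R (LinearMap.ker g) = 0 := by omega
  have h3 : Module.IsTorsion R (LinearMap.ker g) := Module.finrank_eq_zero_iff_isTorsion.mp h2
  rw [eq_bot_iff]
  intro x hx
  obtain ⟨a, ha⟩ := @h3 ⟨x, hx⟩
  have ha' : (a : R) • x = 0 := congrArg Subtype.val ha
  simpa [nonZeroDivisors.coe_ne_zero a] using ha'

end Rank

theorem Module.finrank_quotient_torsion {R M : Type*} [CommRing R] [AddCommGroup M] [Module R M] :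
    Module.finrank R (M ⧸ Submodule.torsion R M) = Module.finrank R M :=
  finrank_quotient_eq_of_le_torsion le_rfl

/-! ### Steinitz's structure theorem and the rank conditions -/

section Steinitz

variable {R : Type*} [CommRing R] [IsDedekindDomain R]

instance Module.projective_of_isTorsionFree_of_isDedekindDomain (P : Type*) [AddCommGroup P]
    [Module R P] [Module.Finite R P] [Module.IsTorsionFree R P] : Module.Projective R P :=
  have : Module.FinitePresentation R P := Module.finitePresentation_of_finite R P
  Module.Flat.projective_of_finitePresentation

/-- Multiplicativity of the Steinitz class. The extra `1` in `k` is the free summand of `I ⊕ I' ≅ R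
⊕ I I'`. -/
theorem nonempty_prod_equiv_of_steinitz {P P' : Type*} [AddCommGroup P] [Module R P]
    [AddCommGroup P'] [Module R P'] {n n' k : ℕ} {I I' : (Ideal R)⁰}
    (e : P ≃ₗ[R] ((Fin n → R) × (I : Ideal R))) (e' : P' ≃ₗ[R] ((Fin n' → R) × (I' : Ideal R)))
    (hk : k = n + n' + 1) :
    Nonempty ((P × P') ≃ₗ[R] ((Fin k → R) × ((I * I' : (Ideal R)⁰) : Ideal R))) := by
  obtain ⟨f⟩ := nonempty_ideal_prod_equiv I I'
  let g : (((Fin n → R) × (Fin n' → R)) × R) ≃ₗ[R] (Fin k → R) :=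
    LinearEquiv.ofFinrankEq _ _ (by simp [hk])
  exact ⟨e.prodCongr e' ≪≫ₗ LinearEquiv.prodProdProdComm R _ _ _ _ ≪≫ₗ
    (LinearEquiv.refl R _).prodCongr f ≪≫ₗ (LinearEquiv.prodAssoc R _ _ _).symm ≪≫ₗ
    g.prodCongr (.refl R _)⟩

/-- Functionals separate the points of a projective module, and a nonzero ideal has rank one. -/
theorem exists_dual_finrank_range_eq_one (P : Type*) [AddCommGroup P] [Module R P]
    [Module.Projective R P] [Nontrivial P] :
    ∃ φ : Module.Dual R P, LinearMap.range φ ≠ ⊥ ∧ Module.finrank R (LinearMap.range φ) = 1 := by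
  obtain ⟨v, hv⟩ := exists_ne (0 : P)
  obtain ⟨φ, hφ⟩ : ∃ φ : Module.Dual R P, φ v ≠ 0 := by
    by_contra! h
    exact hv ((Module.forall_dual_apply_eq_zero_iff R v).mp h)
  have hne : LinearMap.range φ ≠ ⊥ := fun h => hφ (by simpa [h] using LinearMap.mem_range_self φ v)
  have : Nontrivial (LinearMap.range φ) := Submodule.nontrivial_iff_ne_bot.mpr hne
  have h1 : 0 < Module.finrank R (LinearMap.range φ) := Module.finrank_pos
  have h2 := Submodule.finrank_le (LinearMap.range φ)
  rw [Module.finrank_self] at h2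
  exact ⟨φ, hne, by omega⟩

/-- Steinitz: a finitely generated torsion-free module of rank `n + 1` is `R ^ n ⊕ I`. -/
theorem exists_steinitz_equiv (n : ℕ) : ∀ (P : Type*) [AddCommGroup P] [Module R P]
    [Module.Finite R P] [Module.IsTorsionFree R P], Module.finrank R P = n + 1 →
    ∃ I : (Ideal R)⁰, Nonempty (P ≃ₗ[R] ((Fin n → R) × (I : Ideal R))) := by
  induction n with
  | zero =>
    intro P _ _ _ _ hP
    have : Nontrivial P := Module.nontrivial_of_finrank_pos (R := R) (by omega)
    obtain ⟨φ, hne, hone⟩ := exists_dual_finrank_range_eq_one (R := R) P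
    have h := φ.rangeRestrict.ker_eq_bot_of_surjective_of_finrank_eq φ.surjective_rangeRestrict
      (by omega)
    refine ⟨⟨LinearMap.range φ, mem_nonZeroDivisors_of_ne_zero hne⟩, ⟨?_⟩⟩
    exact LinearEquiv.ofBijective φ.rangeRestrict
      ⟨LinearMap.ker_eq_bot.mp h, φ.surjective_rangeRestrict⟩ ≪≫ₗ LinearEquiv.uniqueProd.symm
  | succ n ih =>
    intro P _ _ _ _ hP
    have : Nontrivial P := Module.nontrivial_of_finrank_pos (R := R) (by omega)
    -- The image of `φ` is a nonzero ideal, hence projective, so it splits off and leaves a kernel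
    -- of rank one less.
    obtain ⟨φ, hne, hone⟩ := exists_dual_finrank_range_eq_one (R := R) P
    have h := φ.rangeRestrict.finrank_add_finrank_ker_of_surjective φ.surjective_rangeRestrict
    obtain ⟨I, ⟨e⟩⟩ := ih (LinearMap.ker φ.rangeRestrict) (by omega)
    obtain ⟨e', -⟩ := φ.rangeRestrict.exists_equiv_ker_prod_of_surjective φ.surjective_rangeRestrict
    obtain ⟨e''⟩ := nonempty_prod_equiv_of_steinitz (n' := 0) (k := n + 1)
      (I' := ⟨LinearMap.range φ, mem_nonZeroDivisors_of_ne_zero hne⟩) e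
      LinearEquiv.uniqueProd.symm rfl
    exact ⟨_, ⟨e'.symm ≪≫ₗ e''⟩⟩

theorem nonempty_fin_fun_equiv_of_steinitz {P : Type*} [AddCommGroup P] [Module R P] {n : ℕ}
    {I : (Ideal R)⁰} (e : P ≃ₗ[R] ((Fin n → R) × (I : Ideal R))) (t k : ℕ)
    (hk : k + 1 = (t + 1) * (n + 1)) :
    Nonempty ((Fin (t + 1) → P) ≃ₗ[R] ((Fin k → R) × ((I ^ (t + 1) : (Ideal R)⁰) : Ideal R))) := by
  induction t generalizing k with
  | zero =>
    obtain rfl : k = n := by omega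
    rw [zero_add, pow_one]
    exact ⟨LinearEquiv.funUnique (Fin 1) R P ≪≫ₗ e⟩
  | succ t ih =>
    obtain ⟨j, hj⟩ : ∃ j, j + 1 = (t + 1) * (n + 1) := ⟨(t + 1) * (n + 1) - 1, by
      have := Nat.mul_pos t.succ_pos n.succ_pos
      simp only [Nat.succ_eq_add_one] at this
      omega⟩
    obtain ⟨f⟩ := ih j hj
    rw [pow_succ']
    obtain ⟨g⟩ := nonempty_prod_equiv_of_steinitz (k := k) e f (by linarith [hj, hk])
    exact ⟨(Fin.consLinearEquiv R fun _ : Fin (t + 2) => P).symm ≪≫ₗ g⟩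

theorem mk0_eq_mk0_of_steinitz_equiv {n : ℕ} {I J : (Ideal R)⁰}
    (e : ((Fin n → R) × (I : Ideal R)) ≃ₗ[R] ((Fin n → R) × (J : Ideal R))) :
    ClassGroup.mk0 I = ClassGroup.mk0 J := by
  obtain ⟨x, y, hx, hy, h⟩ := exists_span_singleton_mul_eq_of_equiv
    (nonZeroDivisors.coe_ne_zero I) (nonZeroDivisors.coe_ne_zero J) e
  exact ClassGroup.mk0_eq_mk0_iff.mpr ⟨x, y, hx, hy, h⟩

/-- Makes the choice in the definition harmless: the chosen ideal and `I` give isomorphic modules,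
so their classes agree. -/
theorem steinitzClass_eq_mk0 {M : Type*} [AddCommGroup M] [Module R M] {n : ℕ}
    (hM : Module.finrank R M = n + 1) {I : (Ideal R)⁰}
    (e : (M ⧸ Submodule.torsion R M) ≃ₗ[R] ((Fin n → R) × (I : Ideal R))) :
    steinitzClass R M = ClassGroup.mk0 I := by
  have hn : Module.finrank R M - 1 = n := by omega
  have h : ∃ I : (Ideal R)⁰, IsSteinitzIdeal M I := ⟨I, by rw [IsSteinitzIdeal, hn]; exact ⟨e⟩⟩
  rw [steinitzClass, dif_pos h]
  have h' := h.choose_spec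
  rw [IsSteinitzIdeal, hn] at h'
  obtain ⟨e'⟩ := h'
  exact mk0_eq_mk0_of_steinitz_equiv (e'.symm ≪≫ₗ e)

theorem exists_steinitzClass_eq {M : Type*} [AddCommGroup M] [Module R M] [Module.Finite R M]
    {n : ℕ} (hM : Module.finrank R M = n + 1) :
    ∃ I : (Ideal R)⁰, steinitzClass R M = ClassGroup.mk0 I ∧
      Nonempty ((M ⧸ Submodule.torsion R M) ≃ₗ[R] ((Fin n → R) × (I : Ideal R))) := by
  obtain ⟨I, ⟨e⟩⟩ := exists_steinitz_equiv n (M ⧸ Submodule.torsion R M)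
    (by rw [Module.finrank_quotient_torsion, hM])
  exact ⟨I, steinitzClass_eq_mk0 hM e, ⟨e⟩⟩

/-- A torsion-free module surjects onto every torsion-free module of smaller rank. -/
theorem exists_surjective_of_finrank_lt {F Q : Type*} [AddCommGroup F] [Module R F]
    [Module.Finite R F] [Module.IsTorsionFree R F] [AddCommGroup Q] [Module R Q]
    [Module.Finite R Q] [Module.IsTorsionFree R Q]
    (h : Module.finrank R Q < Module.finrank R F) :
    ∃ f : F →ₗ[R] Q, Function.Surjective f := by
  obtain ⟨d, hd⟩ := Nat.exists_eq_add_of_lt h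
  rcases hq : Module.finrank R Q with _ | q
  · have : Subsingleton Q := by
      by_contra hQ
      rw [not_subsingleton_iff_nontrivial] at hQ
      have := Module.finrank_pos (R := R) (M := Q)
      omega
    exact ⟨0, fun x => ⟨0, Subsingleton.elim _ _⟩⟩
  obtain ⟨I, ⟨e⟩⟩ := exists_steinitz_equiv _ F hd
  obtain ⟨J, ⟨e'⟩⟩ := exists_steinitz_equiv _ Q hq
  -- The strict inequality of ranks leaves room for a complement `R ^ d ⊕ L` of `Q`, with `L` chosen
  -- to correct the class so that `F ≅ Q ⊕ R ^ d ⊕ L`.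
  obtain ⟨L, hL⟩ := ClassGroup.mk0_surjective (ClassGroup.mk0 I * (ClassGroup.mk0 J)⁻¹)
  obtain ⟨u⟩ := nonempty_prod_equiv_of_steinitz (P' := (Fin d → R) × ↥(L : Ideal R))
    (k := q + 1 + d) e'
    (LinearEquiv.refl R _) (by omega)
  obtain ⟨v⟩ := ClassGroup.nonempty_equiv_of_mk0_eq (I := I) (J := J * L) (by simp [hL])
  rw [hq] at e
  let w := e ≪≫ₗ (LinearEquiv.refl R (Fin (q + 1 + d) → R)).prodCongr v ≪≫ₗ u.symm
  exact ⟨LinearMap.fst R Q ((Fin d → R) × ↥(L : Ideal R)) ∘ₗ w.toLinearMap,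
    (LinearMap.fst_surjective (R := R)).comp w.surjective⟩

variable {M N : Type*} [AddCommGroup M] [Module R M] [Module.Finite R M] [AddCommGroup N]
  [Module R N] [Module.Finite R N] {t : ℕ}

theorem exists_steinitzClass_pow_eq {s : ℕ} (hN : Module.finrank R N = s + 1) (ht : 0 < t) {k : ℕ}
    (hk : k + 1 = t * (s + 1)) :
    ∃ I : (Ideal R)⁰, steinitzClass R N ^ t = ClassGroup.mk0 I ∧
      Nonempty ((Fin t → N ⧸ Submodule.torsion R N) ≃ₗ[R] ((Fin k → R) × (I : Ideal R))) := by
  obtain ⟨t, rfl⟩ := Nat.exists_eq_succ_of_ne_zero ht.ne'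
  obtain ⟨J, hJ, ⟨e⟩⟩ := exists_steinitzClass_eq hN
  exact ⟨J ^ (t + 1), by rw [hJ, map_pow], nonempty_fin_fun_equiv_of_steinitz e t k hk⟩

/-- Equal rank and equal class make the torsion-free quotient of `M` isomorphic to the target. -/
theorem exists_surjective_of_steinitzCondition (ht : 0 < t) (h : SteinitzCondition R M N t) :
    ∃ f : M →ₗ[R] (Fin t → N ⧸ Submodule.torsion R N), Function.Surjective f := by
  obtain ⟨h1, h2, h3⟩ := h
  obtain ⟨s, hs⟩ := Nat.exists_eq_succ_of_ne_zero (n := Module.finrank R N) (by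
    rintro h0; rw [h0] at h2; omega)
  obtain ⟨k, hk⟩ := Nat.exists_eq_succ_of_ne_zero (n := t * (s + 1)) (by positivity)
  obtain ⟨I, hI, ⟨e⟩⟩ := exists_steinitzClass_pow_eq hs ht hk.symm
  obtain ⟨J, hJ, ⟨e'⟩⟩ := exists_steinitzClass_eq (M := M) (n := k) (by rw [h1, hs]; exact hk)
  obtain ⟨v⟩ := ClassGroup.nonempty_equiv_of_mk0_eq (I := J) (J := I) (by rw [← hI, ← hJ, h3])
  let w := e' ≪≫ₗ (LinearEquiv.refl R (Fin k → R)).prodCongr v ≪≫ₗ e.symm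
  exact ⟨w.toLinearMap ∘ₗ (Submodule.torsion R M).mkQ, w.surjective.comp (Submodule.mkQ_surjective _)⟩

theorem exists_surjective_fin_fun_quotient_torsion (ht : 0 < t)
    (h : Module.finrank R N = 0 ∨ 1 + t * Module.finrank R N ≤ Module.finrank R M ∨
      SteinitzCondition R M N t) :
    ∃ f : M →ₗ[R] (Fin t → N ⧸ Submodule.torsion R N), Function.Surjective f := by
  rcases h with h | h | h
  · have : Subsingleton (N ⧸ Submodule.torsion R N) := by
      by_contra hQ
      rw [not_subsingleton_iff_nontrivial] at hQ
      have := Module.finrank_pos (R := R) (M := N ⧸ Submodule.torsion R N)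
      rw [Module.finrank_quotient_torsion] at this
      omega
    exact ⟨0, fun x => ⟨0, Subsingleton.elim _ _⟩⟩
  · obtain ⟨f, hf⟩ := exists_surjective_of_finrank_lt (R := R) (F := M ⧸ Submodule.torsion R M)
      (Q := Fin t → N ⧸ Submodule.torsion R N) (by
        rw [Module.finrank_fin_fun_eq_mul, Module.finrank_quotient_torsion,
          Module.finrank_quotient_torsion]; omega)
    exact ⟨f ∘ₗ (Submodule.torsion R M).mkQ, hf.comp (Submodule.mkQ_surjective _)⟩
  · exact exists_surjective_of_steinitzCondition ht h

/-- A map to a torsion-free module factors through the torsion-free quotient; if the ranks agree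
and the map is surjective, its kernel is the torsion submodule. -/
theorem LinearMap.ker_eq_torsion_of_surjective {Q : Type*} [AddCommGroup Q] [Module R Q]
    [Module.IsTorsionFree R Q] (f : M →ₗ[R] Q) (hf : Function.Surjective f)
    (h : Module.finrank R M = Module.finrank R Q) : LinearMap.ker f = Submodule.torsion R M := by
  have hle : Submodule.torsion R M ≤ LinearMap.ker f := by
    rintro x ⟨a, ha⟩
    have h1 : (a : R) • f x = 0 := by rw [← map_smul]; exact (congrArg f ha).trans (map_zero f)
    simpa [nonZeroDivisors.coe_ne_zero a] using h1
  refine le_antisymm (fun x hx => ?_) hle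
  have hsurj : Function.Surjective ((Submodule.torsion R M).liftQ f hle) := by
    intro y
    obtain ⟨x, rfl⟩ := hf y
    exact ⟨Submodule.Quotient.mk x, by simp⟩
  have hker := LinearMap.ker_eq_bot_of_surjective_of_finrank_eq _ hsurj
    (by rw [Module.finrank_quotient_torsion, h])
  have : Submodule.Quotient.mk (p := Submodule.torsion R M) x = 0 := by
    rw [← Submodule.mem_bot R, ← hker, LinearMap.mem_ker]
    simpa using hx
  exact (Submodule.Quotient.mk_eq_zero _).mp this

theorem steinitzCondition_of_surjective (ht : 0 < t) (hN : Module.finrank R N ≠ 0)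
    (hMN : Module.finrank R M = t * Module.finrank R N) (f : M →ₗ[R] (Fin t → N))
    (hf : Function.Surjective f) : SteinitzCondition R M N t := by
  obtain ⟨s, hs⟩ := Nat.exists_eq_succ_of_ne_zero hN
  refine ⟨hMN, Nat.le_mul_of_pos_right t (Nat.pos_of_ne_zero hN), ?_⟩
  obtain ⟨k, hk⟩ := Nat.exists_eq_succ_of_ne_zero (n := t * (s + 1)) (by positivity)
  obtain ⟨I, hI, ⟨e⟩⟩ := exists_steinitzClass_pow_eq hs ht hk.symm
  let g : M →ₗ[R] (Fin t → N ⧸ Submodule.torsion R N) :=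
    (Submodule.torsion R N).mkQ.compLeft (Fin t) ∘ₗ f
  have hg : Function.Surjective g :=
    ((Submodule.mkQ_surjective _).comp_left).comp hf
  have hker := g.ker_eq_torsion_of_surjective hg (by
    rw [Module.finrank_fin_fun_eq_mul, Module.finrank_quotient_torsion, hMN])
  rw [hI]
  exact steinitzClass_eq_mk0 (n := k) (by rw [hMN, hs]; exact hk)
    (Submodule.quotEquivOfEq _ _ hker.symm ≪≫ₗ g.quotKerEquivOfSurjective hg ≪≫ₗ e)

end Steinitz

/-! ### Cancelling a projective summand modulo a maximal ideal -/

section Cancellation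

/-- Stable range one for linear maps: if `c` and `β` jointly span `V`, some `c + β a` is
invertible. -/
theorem LinearMap.exists_leftInverse_add_comp {k V W : Type*} [Field k] [AddCommGroup V]
    [Module k V] [FiniteDimensional k V] [AddCommGroup W] [Module k W] (c : V →ₗ[k] V)
    (β : W →ₗ[k] V) (h : LinearMap.range c ⊔ LinearMap.range β = ⊤) :
    ∃ (a : V →ₗ[k] W) (d : V →ₗ[k] V), d ∘ₗ (c + β ∘ₗ a) = LinearMap.id := by
  let π := (LinearMap.range c).mkQ
  have hπβ : Function.Surjective (π ∘ₗ β) := by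
    intro y
    obtain ⟨v, rfl⟩ := Submodule.mkQ_surjective _ y
    have hv : v ∈ LinearMap.range c ⊔ LinearMap.range β := h ▸ Submodule.mem_top
    obtain ⟨_, ⟨x, rfl⟩, _, ⟨w, rfl⟩, rfl⟩ := Submodule.mem_sup.mp hv
    exact ⟨w, by simp [π]⟩
  obtain ⟨σ, hσ⟩ := (π ∘ₗ β).exists_rightInverse_of_surjective (LinearMap.range_eq_top.mpr hπβ)
  obtain ⟨ρ, hρ⟩ := (LinearMap.ker c).subtype.exists_leftInverse_of_injective (by simp)
  -- Kernel and cokernel of `c` have equal dimension, so `a` can be chosen to make `β ∘ a` carry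
  -- `ker c` isomorphically onto a complement of the range of `c`.
  let e : LinearMap.ker c ≃ₗ[k] (V ⧸ LinearMap.range c) := LinearEquiv.ofFinrankEq _ _ (by
    have h1 := c.finrank_range_add_finrank_ker
    have h2 := (LinearMap.range c).finrank_quotient_add_finrank
    omega)
  let a := σ ∘ₗ e.toLinearMap ∘ₗ ρ
  obtain ⟨d, hd⟩ := (c + β ∘ₗ a).exists_leftInverse_of_injective (by
    rw [LinearMap.ker_eq_bot']
    intro v hv
    have hv' : c v + β (a v) = 0 := hv
    have h1 : π (c v) = 0 := by simp [π]
    have h2 : π (β (a v)) = e (ρ v) := LinearMap.congr_fun hσ (e (ρ v))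
    have h3 : e (ρ v) = 0 := by
      have h := congrArg π hv'
      rwa [map_add, map_zero, h1, zero_add, h2] at h
    have h4 : ρ v = 0 := by simpa using h3
    have h5 : c v = 0 := by simpa [a, h4] using hv'
    have h6 : ρ v = ⟨v, h5⟩ := LinearMap.congr_fun hρ ⟨v, h5⟩
    simpa [h4] using (congrArg Subtype.val h6).symm)
  exact ⟨a, d, hd⟩

variable {R : Type*} [CommRing R]

theorem Submodule.map_mem_smul_top {A B : Type*} [AddCommGroup A] [Module R A] [AddCommGroup B]
    [Module R B] (p : Ideal R) (g : A →ₗ[R] B) {x : A} (hx : x ∈ p • (⊤ : Submodule R A)) :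
    g x ∈ p • (⊤ : Submodule R B) :=
  Submodule.smul_top_le_comap_smul_top p g hx

/-- The reduction of a linear map modulo an ideal. -/
def LinearMap.mapQuotientSMulTop {A B : Type*} [AddCommGroup A] [Module R A] [AddCommGroup B]
    [Module R B] (p : Ideal R) (g : A →ₗ[R] B) :
    (A ⧸ p • (⊤ : Submodule R A)) →ₗ[R ⧸ p] (B ⧸ p • (⊤ : Submodule R B)) :=
  LinearMap.extendScalarsOfSurjective Ideal.Quotient.mk_surjective
    (Submodule.mapQ _ _ g (Submodule.smul_top_le_comap_smul_top p g))

/-- A surjection `K ⊕ Q → T ⊕ Q` modulo a maximal ideal, with `Q` finitely generated projective,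
yields a map `K → T` that is surjective modulo this ideal. -/
theorem LinearMap.exists_range_sup_smul_top_of_prod {K T Q : Type*} [AddCommGroup K] [Module R K]
    [AddCommGroup T] [Module R T] [AddCommGroup Q] [Module R Q] [Module.Finite R Q]
    [Module.Projective R Q] (p : Ideal R) [p.IsMaximal] (f : (K × Q) →ₗ[R] (T × Q))
    (hf : LinearMap.range f ⊔ p • ⊤ = ⊤) :
    ∃ h : K →ₗ[R] T, LinearMap.range h ⊔ p • ⊤ = ⊤ := by
  let := Ideal.Quotient.field p
  -- View `f` as the block matrix with rows `(α, b)` and `(β, c)`. A column operation by `a`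
  -- replaces `c` by `c + β a`, invertible modulo `p`. Projectivity of `Q` lifts `a` and the inverse
  -- `d` to `R`.
  let α : K →ₗ[R] T := LinearMap.fst R T Q ∘ₗ f ∘ₗ LinearMap.inl R K Q
  let b : Q →ₗ[R] T := LinearMap.fst R T Q ∘ₗ f ∘ₗ LinearMap.inr R K Q
  let β : K →ₗ[R] Q := LinearMap.snd R T Q ∘ₗ f ∘ₗ LinearMap.inl R K Q
  let c : Q →ₗ[R] Q := LinearMap.snd R T Q ∘ₗ f ∘ₗ LinearMap.inr R K Q
  have hsum (k : K) (x : Q) : f (k, x) = f (k, 0) + f (0, x) := by rw [← map_add]; simp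
  have hf1 (k : K) (x : Q) : (f (k, x)).1 = α k + b x := by rw [hsum]; rfl
  have hf2 (k : K) (x : Q) : (f (k, x)).2 = β k + c x := by rw [hsum]; rfl
  have hfT (y : T × Q) : ∃ k x, y.1 - (α k + b x) ∈ p • (⊤ : Submodule R T) ∧
      y.2 - (β k + c x) ∈ p • (⊤ : Submodule R Q) := by
    have hy : y ∈ LinearMap.range f ⊔ p • ⊤ := by rw [hf]; trivial
    obtain ⟨_, ⟨⟨k, x⟩, rfl⟩, z, hz, rfl⟩ := Submodule.mem_sup.mp hy
    refine ⟨k, x, ?_, ?_⟩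
    · rw [← hf1]; simpa using Submodule.map_mem_smul_top p (LinearMap.fst R T Q) hz
    · rw [← hf2]; simpa using Submodule.map_mem_smul_top p (LinearMap.snd R T Q) hz
  obtain ⟨a', d', hd'⟩ := (c.mapQuotientSMulTop p).exists_leftInverse_add_comp (β.mapQuotientSMulTop p) (by
    rw [eq_top_iff]
    rintro y -
    obtain ⟨y, rfl⟩ := Submodule.mkQ_surjective _ y
    obtain ⟨k, x, -, h⟩ := hfT (0, y)
    rw [Submodule.mem_sup]
    refine ⟨_, ⟨Submodule.mkQ _ x, rfl⟩, _, ⟨Submodule.mkQ _ k, rfl⟩, ?_⟩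
    have : Submodule.mkQ (p • ⊤) (β k + c x) = Submodule.mkQ (p • ⊤) y :=
      ((Submodule.Quotient.eq _).mpr h).symm
    rw [← this, map_add, add_comm]; rfl)
  obtain ⟨a, ha⟩ := Module.projective_lifting_property (Submodule.mkQ (p • (⊤ : Submodule R K)))
    (a'.restrictScalars R ∘ₗ Submodule.mkQ (p • (⊤ : Submodule R Q))) (Submodule.mkQ_surjective _)
  obtain ⟨d, hd⟩ := Module.projective_lifting_property (Submodule.mkQ (p • (⊤ : Submodule R Q)))
    (d'.restrictScalars R ∘ₗ Submodule.mkQ (p • (⊤ : Submodule R Q))) (Submodule.mkQ_surjective _)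
  have hdc (x : Q) : d (c x + β (a x)) - x ∈ p • (⊤ : Submodule R Q) := by
    rw [← Submodule.Quotient.eq]
    have h1 : Submodule.mkQ _ (d (c x + β (a x))) = d' (Submodule.mkQ _ (c x + β (a x))) :=
      LinearMap.congr_fun hd _
    have h2 : Submodule.mkQ _ (a x) = a' (Submodule.mkQ _ x) := LinearMap.congr_fun ha _
    have h3 : Submodule.mkQ (p • ⊤) (c x + β (a x)) =
        (c.mapQuotientSMulTop p + β.mapQuotientSMulTop p ∘ₗ a') (Submodule.mkQ _ x) := by
      have h4 := congrArg (β.mapQuotientSMulTop p) h2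
      exact (map_add _ _ _).trans (congrArg (Submodule.mkQ (p • ⊤) (c x) + ·) h4)
    exact h1.trans (by rw [h3]; exact LinearMap.congr_fun hd' _)
  -- This is the Schur complement. If `f (k, x) ≡ (τ, 0)`, then `x ≡ -d (β (k - a x))`, so it sends
  -- `k - a x` to `τ` modulo `p`.
  refine ⟨α - (b + α ∘ₗ a) ∘ₗ d ∘ₗ β, ?_⟩
  rw [eq_top_iff]
  rintro τ -
  obtain ⟨k, x, h1, h2⟩ := hfT (τ, 0)
  refine Submodule.mem_sup.mpr ⟨_, ⟨k - a x, rfl⟩, _, ?_, add_sub_cancel _ τ⟩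
  have h3 : d (β (k - a x)) + x ∈ p • (⊤ : Submodule R Q) := by
    have h4 := Submodule.add_mem _ (Submodule.map_mem_smul_top p d h2) (hdc x)
    have h5 : d (β (k - a x)) + x = -(d (0 - (β k + c x)) + (d (c x + β (a x)) - x)) := by
      simp only [map_sub, map_add, map_zero]; abel
    rw [h5]
    exact Submodule.neg_mem _ h4
  have h6 := Submodule.add_mem _ h1 (Submodule.map_mem_smul_top p (b + α ∘ₗ a) h3)
  convert h6 using 1
  simp only [LinearMap.sub_apply, LinearMap.comp_apply, LinearMap.add_apply, map_sub, map_add]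
  abel

end Cancellation

/-! ### From finitely many maximal ideals to a global surjection -/

section Gluing

variable {R : Type*} [CommRing R]

/-- Nakayama's lemma applied to the cokernel at a maximal ideal containing its annihilator. -/
theorem LinearMap.surjective_of_range_sup_smul_top {K T : Type*} [AddCommGroup K] [Module R K]
    [AddCommGroup T] [Module R T] [Module.Finite R T] (h : K →ₗ[R] T)
    (hh : ∀ p : Ideal R, p.IsMaximal → LinearMap.range h ⊔ p • ⊤ = ⊤) : Function.Surjective h := by
  by_contra hs
  have ha : Module.annihilator R (T ⧸ LinearMap.range h) ≠ ⊤ := by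
    intro ha
    rw [Module.annihilator_eq_top_iff, Submodule.Quotient.subsingleton_iff,
      LinearMap.range_eq_top] at ha
    exact hs ha
  obtain ⟨p, hp, hle⟩ := Ideal.exists_le_maximal _ ha
  obtain ⟨r, hr, hr0⟩ := Submodule.exists_sub_one_mem_and_smul_eq_zero_of_fg_of_le_smul p
    (⊤ : Submodule R (T ⧸ LinearMap.range h)) Module.Finite.fg_top (by
      rintro y -
      obtain ⟨y, rfl⟩ := Submodule.mkQ_surjective _ y
      have hy : y ∈ LinearMap.range h ⊔ p • ⊤ := by rw [hh p hp]; trivial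
      obtain ⟨u, hu, z, hz, rfl⟩ := Submodule.mem_sup.mp hy
      have hu' : (LinearMap.range h).mkQ u = 0 := by simpa using hu
      rw [map_add, hu', zero_add]
      exact Submodule.map_mem_smul_top p (LinearMap.range h).mkQ hz)
  have hrp : r ∈ p := hle (Module.mem_annihilator.mpr fun m => hr0 m Submodule.mem_top)
  exact hp.ne_top ((Ideal.eq_top_iff_one p).mpr (by simpa using p.sub_mem hrp hr))

/-- Maps that are surjective modulo finitely many maximal ideals can be combined by the Chinese
remainder theorem, provided that the other maximal ideals do not matter. -/
theorem LinearMap.exists_surjective_of_finite {K T : Type*} [AddCommGroup K] [Module R K]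
    [AddCommGroup T] [Module R T] [Module.Finite R T] (X : Set (Ideal R)) (hX : X.Finite)
    (hmax : ∀ p ∈ X, p.IsMaximal)
    (hin : ∀ p ∈ X, ∃ h : K →ₗ[R] T, LinearMap.range h ⊔ p • ⊤ = ⊤)
    (hout : ∀ p : Ideal R, p.IsMaximal → p ∉ X → p • (⊤ : Submodule R T) = ⊤) :
    ∃ h : K →ₗ[R] T, Function.Surjective h := by
  classical
  have := hX.fintype
  choose h hh using fun p : X => hin p p.2
  have hco : Pairwise (Function.onFun IsCoprime fun p : X => (p : Ideal R)) := fun p q hpq =>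
    
    have := hmax p p.2
    have := hmax q q.2
    Ideal.isCoprime_of_isMaximal fun e => hpq (Subtype.ext e)
  -- `e p` is `1` modulo `p` and `0` modulo the other members of `X`, so the sum of the `e p • h p`
  -- agrees with `h p` modulo `p`.
  choose e he using fun p : X => Ideal.exists_forall_sub_mem_ideal hco (Pi.single p (1 : R))
  refine ⟨∑ p, e p • h p, LinearMap.surjective_of_range_sup_smul_top _ fun q hq => ?_⟩
  by_cases hqX : q ∈ X
  · refine eq_top_iff.mpr ((hh ⟨q, hqX⟩).ge.trans ?_)
    refine sup_le ?_ le_sup_right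
    rintro _ ⟨k, rfl⟩
    refine Submodule.mem_sup.mpr ⟨_, ⟨k, rfl⟩, _, ?_, add_sub_cancel _ _⟩
    have h1 : h ⟨q, hqX⟩ k - (∑ p, e p • h p) k =
        ∑ p, ((Pi.single p (1 : R) : X → R) ⟨q, hqX⟩ - e p) • h p k := by
      simp only [sub_smul, Finset.sum_sub_distrib, LinearMap.sum_apply, LinearMap.smul_apply]
      congr 1
      rw [Finset.sum_eq_single ⟨q, hqX⟩] <;> simp +contextual [eq_comm]
    rw [h1]
    refine Submodule.sum_mem _ fun p _ => Submodule.smul_mem_smul ?_ Submodule.mem_top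
    rw [← neg_sub]
    exact q.neg_mem (he p ⟨q, hqX⟩)
  · rw [hout q hq hqX, sup_top_eq]

/-- The annihilator of `T` is nonzero. A maximal ideal containing it is minimal over it, because
nonzero primes are maximal, hence is associated. Any other maximal ideal misses an element of the
annihilator, which is a unit modulo `p` and kills `T`. The case `p = ⊥` over a field falls under the
latter. -/
theorem Module.smul_top_eq_top_of_notMem_associatedPrimes [IsDedekindDomain R] {T : Type*}
    [AddCommGroup T] [Module R T] [Module.Finite R T] (hT : Module.IsTorsion R T) (p : Ideal R)
    [hp : p.IsMaximal] (hpT : p ∉ associatedPrimes R T \ {⊥}) : p • (⊤ : Submodule R T) = ⊤ := by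
  obtain ⟨r, hr, hr0⟩ : ∃ r : R, r ≠ 0 ∧ r ∈ Module.annihilator R T := by
    obtain ⟨r, hr, hr0⟩ := Submodule.annihilator_top_inter_nonZeroDivisors hT
    exact ⟨r, nonZeroDivisors.ne_zero hr0, by rwa [← Submodule.annihilator_top]⟩
  by_cases hle : Module.annihilator R T ≤ p
  · have hp0 : p ≠ ⊥ := fun h0 => hr (by simpa [h0] using hle hr0)
    refine absurd ⟨?_, hp0⟩ hpT
    refine Module.associatedPrimes.minimalPrimes_annihilator_subset_associatedPrimes R T
      ⟨⟨hp.isPrime, hle⟩, fun q hq hqp => ?_⟩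
    have hq0 : q ≠ ⊥ := fun h0 => hr (by simpa [h0] using hq.2 hr0)
    exact ((hq.1.isMaximal hq0).eq_of_le hp.ne_top hqp).ge
  · obtain ⟨s, hs, hsp⟩ := SetLike.not_le_iff_exists.mp hle
    obtain ⟨u, v, hv, h⟩ := hp.exists_inv hsp
    rw [eq_top_iff]
    rintro x -
    have h1 : s • x = 0 := Module.mem_annihilator.mp hs x
    have h2 : x = v • x := by
      conv_lhs => rw [← one_smul R x, ← h, add_smul, mul_smul, h1, smul_zero, zero_add]
    rw [h2]
    exact Submodule.smul_mem_smul hv Submodule.mem_top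

theorem associatedPrimes_fin_fun_subset {N : Type*} [AddCommGroup N] [Module R N] (t : ℕ) :
    associatedPrimes R (Fin t → N) ⊆ associatedPrimes R N := by
  induction t with
  | zero => simp [associatedPrimes.eq_empty_of_subsingleton]
  | succ t ih =>
    refine (associatedPrimes.subset_of_injective
      (Fin.consLinearEquiv R fun _ : Fin (t + 1) => N).symm.injective).trans ?_
    rw [associatedPrimes.prod]
    exact Set.union_subset le_rfl ih

end Gluing

/-- Dropping coordinates shows that the admissible exponents are downward closed, so the supremum
can be tested at each `t`, even when it is infinite. -/
theorem natCast_le_surCapacity_iff {R M N : Type*} [CommRing R] [AddCommGroup M] [Module R M]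
    [AddCommGroup N] [Module R N] {t : ℕ} :
    (t : ℕ∞) ≤ surCapacity R M N ↔ ∃ f : M →ₗ[R] (Fin t → N), Function.Surjective f := by
  refine ⟨fun h => ?_, fun h => le_sSup ⟨t, rfl, h⟩⟩
  obtain ⟨s, hts, f, hf⟩ : ∃ s : ℕ, t ≤ s ∧ ∃ f : M →ₗ[R] (Fin s → N), Function.Surjective f := by
    rcases t with _ | t
    · exact ⟨0, le_rfl, 0, fun x => ⟨0, Subsingleton.elim _ _⟩⟩
    · have hlt : (t : ℕ∞) < surCapacity R M N :=
        lt_of_lt_of_le (by exact_mod_cast t.lt_succ_self) h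
      obtain ⟨_, ⟨s, rfl, hs⟩, hts⟩ := lt_sSup_iff.mp hlt
      exact ⟨s, by exact_mod_cast hts, hs⟩
  exact ⟨LinearMap.funLeft R N (Fin.castLE hts) ∘ₗ f,
    (LinearMap.funLeft_surjective_of_injective R N _ (Fin.castLE_injective hts)).comp hf⟩

/-! ### Passing between local surjections and surjections modulo `m` -/

section Localization

variable {R M N : Type*} [CommRing R] [AddCommGroup M] [Module R M] [AddCommGroup N] [Module R N]
  {t : ℕ}

/-- The localization of a finite power, as a finite power of the localization. -/
noncomputable def LocalizedModule.mkFinFun (S : Submonoid R) (N : Type*) [AddCommGroup N]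
    [Module R N] (t : ℕ) : (Fin t → N) →ₗ[R] (Fin t → LocalizedModule S N) :=
  LinearMap.pi fun i => LocalizedModule.mkLinearMap S N ∘ₗ LinearMap.proj i

instance (S : Submonoid R) : IsLocalizedModule S (LocalizedModule.mkFinFun S N t) := by
  unfold LocalizedModule.mkFinFun; infer_instance

theorem le_localSurCapacity_of_surjective (f : M →ₗ[R] (Fin t → N)) (hf : Function.Surjective f)
    (m : PrimeSpectrum R) : (t : ℕ∞) ≤ localSurCapacity M N m := by
  rw [localSurCapacity, natCast_le_surCapacity_iff]
  let S := m.asIdeal.primeCompl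
  refine ⟨(IsLocalizedModule.map S (LocalizedModule.mkLinearMap S M)
    (LocalizedModule.mkFinFun S N t) f).extendScalarsOfIsLocalization S
      (Localization.AtPrime m.asIdeal), ?_⟩
  exact IsLocalizedModule.map_surjective S _ _ f hf

/-- Finite presentation lets a local surjection be lifted to `R` after multiplication by a
denominator `s`. Denominators are units modulo `m`, so surjectivity survives there. -/
theorem exists_range_sup_smul_top_of_le_localSurCapacity [Module.FinitePresentation R M]
    (m : PrimeSpectrum R) [hm : m.asIdeal.IsMaximal] (h : (t : ℕ∞) ≤ localSurCapacity M N m) :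
    ∃ f : M →ₗ[R] (Fin t → N), LinearMap.range f ⊔ m.asIdeal • ⊤ = ⊤ := by
  rw [localSurCapacity, natCast_le_surCapacity_iff] at h
  obtain ⟨φ, hφ⟩ := h
  let S := m.asIdeal.primeCompl
  obtain ⟨f, s, hf⟩ := Module.FinitePresentation.exists_lift_of_isLocalizedModule S
    (LocalizedModule.mkFinFun S N t) (φ.restrictScalars R ∘ₗ LocalizedModule.mkLinearMap S M)
  refine ⟨f, ?_⟩
  rw [eq_top_iff]
  rintro y -
  obtain ⟨u, hu, x, hx⟩ : ∃ u ∈ S, ∃ x, u • y = f x := by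
    obtain ⟨z, hz⟩ := hφ (LocalizedModule.mkFinFun S N t y)
    obtain ⟨⟨x, s'⟩, hx⟩ := IsLocalizedModule.surj S (LocalizedModule.mkLinearMap S M) z
    have h1 : LocalizedModule.mkFinFun S N t (f x) =
        (s : R) • φ (LocalizedModule.mkLinearMap S M x) := LinearMap.congr_fun hf x
    have h2 : LocalizedModule.mkFinFun S N t (f x) =
        LocalizedModule.mkFinFun S N t ((s : R) • (s' : R) • y) := by
      have h3 : φ ((s' : R) • z) = (s' : R) • φ z := (φ.restrictScalars R).map_smul (s' : R) z
      rw [h1, map_smul, map_smul, ← hz, ← h3]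
      exact congrArg (fun w => (s : R) • φ w) hx.symm
    obtain ⟨c, hc⟩ := IsLocalizedModule.exists_of_eq (S := S) h2
    refine ⟨c * (s * s'), S.mul_mem c.2 (S.mul_mem s.2 s'.2), (c : R) • x, ?_⟩
    rw [map_smul, mul_smul, mul_smul]
    exact hc.symm
  obtain ⟨a, v, hv, hav⟩ := hm.exists_inv hu
  refine Submodule.mem_sup.mpr ⟨f (a • x), ⟨_, rfl⟩, v • y,
    Submodule.smul_mem_smul hv Submodule.mem_top, ?_⟩
  rw [map_smul, ← hx, ← mul_smul, ← add_smul, hav, one_smul]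

end Localization

/-- The torsion submodule of a finite power, as the kernel of the map to the torsion-free
quotients. -/
theorem mem_ker_compLeft_mkQ_torsion {R N : Type*} [CommRing R] [AddCommGroup N]
    [Module R N] {t : ℕ} {x : Fin t → N} :
    x ∈ LinearMap.ker ((Submodule.torsion R N).mkQ.compLeft (Fin t)) ↔
      ∀ i, x i ∈ Submodule.torsion R N := by
  rw [LinearMap.mem_ker, funext_iff]
  exact forall_congr' fun i => Submodule.Quotient.mk_eq_zero _

theorem isTorsion_ker_compLeft_mkQ_torsion {R N : Type*} [CommRing R]
    [AddCommGroup N] [Module R N] {t : ℕ} :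
    Module.IsTorsion R (LinearMap.ker ((Submodule.torsion R N).mkQ.compLeft (Fin t))) := by
  rintro ⟨x, hx⟩
  rw [mem_ker_compLeft_mkQ_torsion] at hx
  choose a ha using fun i => (Submodule.mem_torsion_iff (x i)).mp (hx i)
  refine ⟨∏ i, a i, Subtype.ext (funext fun i => ?_)⟩
  obtain ⟨b, hb⟩ := Finset.dvd_prod_of_mem a (Finset.mem_univ i)
  change (∏ i, a i) • x i = 0
  rw [hb, mul_comm, mul_smul, ha, smul_zero]

/-! ### Assembling the global surjection; torsion in the equal rank case -/

section DedekindDomain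

variable {R M N : Type*} [CommRing R] [IsDedekindDomain R] [AddCommGroup M] [Module R M]
  [Module.Finite R M] [AddCommGroup N] [Module R N] [Module.Finite R N] {t : ℕ}

/-- If `M` maps onto the torsion-free quotient of `N ^ t` and locally onto `N ^ t` at the nonzero
associated primes of `N`, then it maps onto `N ^ t`. -/
theorem exists_surjective_of_le_localSurCapacity
    (g : M →ₗ[R] (Fin t → N ⧸ Submodule.torsion R N)) (hg : Function.Surjective g)
    (hloc : ∀ m : PrimeSpectrum R, m.asIdeal ∈ associatedPrimes R N \ {⊥} →
      (t : ℕ∞) ≤ localSurCapacity M N m) :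
    ∃ f : M →ₗ[R] (Fin t → N), Function.Surjective f := by
  have : Module.FinitePresentation R M := Module.finitePresentation_of_finite R M
  let π := (Submodule.torsion R N).mkQ.compLeft (Fin t)
  have hπ : Function.Surjective π := (Submodule.mkQ_surjective _).comp_left
  obtain ⟨e, -⟩ := g.exists_equiv_ker_prod_of_surjective hg
  obtain ⟨e', -⟩ := π.exists_equiv_ker_prod_of_surjective hπ
  have hmax : ∀ p ∈ associatedPrimes R N \ {⊥}, p.IsMaximal := fun p hp =>
    hp.1.isPrime.isMaximal hp.2
  obtain ⟨h, hh⟩ := LinearMap.exists_surjective_of_finite (K := LinearMap.ker g)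
    (T := LinearMap.ker π) (associatedPrimes R N \ {⊥})
    ((associatedPrimes.finite R N).subset Set.sdiff_subset) hmax (fun p hp => by
      have := hmax p hp
      obtain ⟨f, hf⟩ := exists_range_sup_smul_top_of_le_localSurCapacity
        (hm := this) ⟨p, hp.1.isPrime⟩ (hloc ⟨p, hp.1.isPrime⟩ hp)
      refine LinearMap.exists_range_sup_smul_top_of_prod p
        (e'.symm.toLinearMap ∘ₗ f ∘ₗ e.toLinearMap) ?_
      rw [eq_top_iff]
      rintro y -
      have hy : e' y ∈ LinearMap.range f ⊔ p • ⊤ := by rw [hf]; trivial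
      obtain ⟨_, ⟨x, rfl⟩, z, hz, hxz⟩ := Submodule.mem_sup.mp hy
      refine Submodule.mem_sup.mpr ⟨_, ⟨e.symm x, rfl⟩, e'.symm z,
        Submodule.map_mem_smul_top p e'.symm.toLinearMap hz, ?_⟩
      rw [LinearMap.comp_apply, LinearMap.comp_apply, LinearEquiv.coe_coe, LinearEquiv.coe_coe,
        LinearEquiv.apply_symm_apply, ← map_add, hxz, LinearEquiv.symm_apply_apply])
    -- The kernel of `π` is torsion and embeds in `N ^ t`, so its associated primes are among those
    -- of `N`.
    (fun p hp hpN => Module.smul_top_eq_top_of_notMem_associatedPrimes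
      isTorsion_ker_compLeft_mkQ_torsion p fun hpT => hpN ⟨associatedPrimes_fin_fun_subset t
        (associatedPrimes.subset_of_injective (Submodule.subtype_injective _) hpT.1), hpT.2⟩)
  exact ⟨e'.toLinearMap ∘ₗ h.prodMap LinearMap.id ∘ₗ e.symm.toLinearMap,
    e'.surjective.comp ((hh.prodMap Function.surjective_id).comp e.symm.surjective)⟩

theorem finrank_le_of_surjective_fin_fun (f : M →ₗ[R] (Fin t → N)) (hf : Function.Surjective f) :
    t * Module.finrank R N ≤ Module.finrank R M := by
  rw [← Module.finrank_fin_fun_eq_mul, ← f.finrank_add_finrank_ker_of_surjective hf]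
  exact Nat.le_add_right _ _

/-- When the ranks agree, a surjection `M → N ^ t` restricts to one of the torsion submodules. -/
theorem exists_surjective_torsion_of_finrank_eq (f : M →ₗ[R] (Fin t → N))
    (hf : Function.Surjective f) (h : Module.finrank R M = t * Module.finrank R N) :
    ∃ g : Submodule.torsion R M →ₗ[R] (Fin t → Submodule.torsion R N), Function.Surjective g := by
  let π := (Submodule.torsion R N).mkQ.compLeft (Fin t)
  have hπ : Function.Surjective π := (Submodule.mkQ_surjective _).comp_left
  have hker := (π ∘ₗ f).ker_eq_torsion_of_surjective (hπ.comp hf) (by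
    rw [Module.finrank_fin_fun_eq_mul, Module.finrank_quotient_torsion, h])
  refine ⟨LinearMap.pi fun i => LinearMap.codRestrict _
    (LinearMap.proj i ∘ₗ f ∘ₗ (Submodule.torsion R M).subtype) fun x => ?_, fun y => ?_⟩
  · have hx : f x ∈ LinearMap.ker π := hker.ge x.2
    exact mem_ker_compLeft_mkQ_torsion.mp hx i
  · obtain ⟨x, hx⟩ := hf fun i => (y i : N)
    have hx' : x ∈ Submodule.torsion R M := by
      refine hker.le ?_
      change f x ∈ LinearMap.ker π
      rw [mem_ker_compLeft_mkQ_torsion, hx]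
      exact fun i => (y i).2
    exact ⟨⟨x, hx'⟩, funext fun i => Subtype.ext (congrFun hx i)⟩

end DedekindDomain

theorem mainTheorem9 {R M N : Type*} [CommRing R] [IsDedekindDomain R]
    [AddCommGroup M] [Module R M] [Module.Finite R M]
    [AddCommGroup N] [Module R N] [Module.Finite R N] (t : ℕ) (ht : 0 < t) :
    ((t : ℕ∞) ≤ surCapacity R M N ↔
      (∀ m : PrimeSpectrum R, m.asIdeal ∈ associatedPrimes R N \ {⊥} →
          (t : ℕ∞) ≤ localSurCapacity M N m) ∧
        (Module.finrank R N = 0 ∨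
          1 + t * Module.finrank R N ≤ Module.finrank R M ∨
          SteinitzCondition R M N t)) ∧
    ((t : ℕ∞) ≤ surCapacity R M N → SteinitzCondition R M N t →
      (t : ℕ∞) ≤ surCapacity R (Submodule.torsion R M) (Submodule.torsion R N) ∧
        surCapacity R M N = t) := by
  refine ⟨⟨fun h => ?_, fun ⟨hloc, hrank⟩ => ?_⟩, fun h hS => ?_⟩
  · obtain ⟨f, hf⟩ := natCast_le_surCapacity_iff.mp h
    refine ⟨fun m _ => le_localSurCapacity_of_surjective f hf m, ?_⟩
    have hle := finrank_le_of_surjective_fin_fun f hf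
    by_cases hN : Module.finrank R N = 0
    · exact Or.inl hN
    rcases hle.eq_or_lt with heq | hlt
    · exact Or.inr (Or.inr (steinitzCondition_of_surjective ht hN heq.symm f hf))
    · exact Or.inr (Or.inl (by omega))
  · obtain ⟨g, hg⟩ := exists_surjective_fin_fun_quotient_torsion ht hrank
    exact natCast_le_surCapacity_iff.mpr (exists_surjective_of_le_localSurCapacity g hg hloc)
  · obtain ⟨f, hf⟩ := natCast_le_surCapacity_iff.mp h
    refine ⟨natCast_le_surCapacity_iff.mpr (exists_surjective_torsion_of_finrank_eq f hf hS.1),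
      le_antisymm (sSup_le ?_) h⟩
    rintro _ ⟨s, rfl, f', hf'⟩
    have h1 := finrank_le_of_surjective_fin_fun f' hf'
    rw [hS.1] at h1
    -- The clause `t ≤ t * rank N`, with `t > 0`, excludes rank zero, so `s * rank N ≤ t * rank N`
    -- can be cancelled to `s ≤ t`.
    have h2 : 0 < Module.finrank R N := Nat.pos_of_ne_zero fun h0 => by
      have := hS.2.1
      rw [h0] at this
      omega
    exact_mod_cast Nat.le_of_mul_le_mul_right h1 h2
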